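/- Let $0<R_1<R_2$ and put $R_-=R_2-R_1$, $R_+=R_1+R_2$. Two nodes have independent random positions $X,Y$ in $\mathbb R^3$; node 1 ($X$) is confined to the ball of radius $R_1$ about the origin and node 2 ($Y$) to the ball of radius $R_2$ about the origin. A \emph{static} node in the ball of radius $R$ is uniformly distributed in that ball; a \emph{mobile} (random waypoint, RWP) node in the ball of radius $R$ has the spatial density $$\frac{35}{288\pi}\left(\frac{21}{R^3}-\frac{34\|x\|^2}{R^5}+\frac{13\|x\|^4}{R^7}\right),\qquad \|x\|\le R,$$ i.e. an isotropic law with radial density $\frac{35}{72}\left(\frac{21\rho^2}{R^3}-\frac{34\rho^4}{R^5}+\frac{13\rho^6}{R^7}\right)$ on $0\le\rho\le R$. There are four scenarios: (s1) node 1 mobile, node 2 static; (s2) node 1 static, node 2 mobile; (s3) both mobile; (s4) both static. In each scenario the internodal distance $r=\|X-Y\|$ has the probability density function (nonnegative, and zero outside $[0,R_+]$) $$f(r)=\begin{cases}\sum_{n=1}^{3}a_{2n}r^{2n},&0\le r<R_-,\\[2pt] \sum_{n=1}^{13}b_nr^n,&R_-\le r\le R_+,\end{cases}$$ where $b_8=b_{10}=b_{12}=0$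 and the other coefficients are as follows (those not listed are $0$). (s1) $a_2=\frac{3}{R_2^3}$; $b_1=\frac{35(29R_1^2-13R_2^2)(R_2^2-R_1^2)^3}{2304R_1^7R_2^3}$, $b_2=\frac{72R_1^7+245R_1^4R_2^3-238R_1^2R_2^5+65R_2^7}{48R_1^7R_2^3}$, $b_3=\frac{35(R_2^2-R_1^2)(25R_1^4+88R_1^2R_2^2-65R_2^4)}{576R_1^7R_2^3}$, $b_4=\frac{35(13R_2^2-17R_1^2)}{72R_1^7}$, $b_5=\frac{35(7R_1^4+34R_1^2R_2^2-65R_2^4)}{384R_1^7R_2^3}$, $b_6=\frac{455}{144R_1^7}$, $b_7=-\frac{7(17R_1^2+65R_2^2)}{576R_1^7R_2^3}$, $b_9=\frac{65}{2304R_1^7R_2^3}$. (s2) $a_2=\frac{65R_1^4-238R_1^2R_2^2+245R_2^4}{24R_2^7}$, $a_4=\frac{35(13R_1^2-17R_2^2)}{36R_2^7}$, $a_6=\frac{455}{72R_2^7}$; $b_1=\frac{35(13R_1^2-29R_2^2)(R_2^2-R_1^2)^3}{2304R_2^7R_1^3}$, $b_2=\frac{72R_2^7+245R_2^4R_1^3-238R_2^2R_1^5+65R_1^7}{48R_2^7R_1^3}$,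 $b_3=\frac{35(R_2^2-R_1^2)(65R_1^4-25R_2^4-88R_2^2R_1^2)}{576R_2^7R_1^3}$, $b_4=\frac{35(13R_1^2-17R_2^2)}{72R_2^7}$, $b_5=\frac{35(7R_2^4+34R_2^2R_1^2-65R_1^4)}{384R_2^7R_1^3}$, $b_6=\frac{455}{144R_2^7}$, $b_7=-\frac{7(17R_2^2+65R_1^2)}{576R_2^7R_1^3}$, $b_9=\frac{65}{2304R_2^7R_1^3}$. (s3) $a_2=\frac{35(2275R_1^4-11594R_1^2R_2^2+18711R_2^4)}{64152R_2^7}$, $a_4=\frac{35(2015R_1^2-4131R_2^2)}{8748R_2^7}$, $a_6=\frac{455}{72R_2^7}$; $b_1=\frac{245(R_2^2-R_1^2)^4(1442R_1^2R_2^2-481(R_1^4+R_2^4))}{1492992R_1^7R_2^7}$, $b_2=\frac{35(2275(R_1^{11}+R_2^{11})-11594(R_1^9R_2^2+R_1^2R_2^9)+18711(R_1^7R_2^4+R_1^4R_2^7))}{128304R_1^7R_2^7}$, $b_3=\frac{1225(R_2^2-R_1^2)^2(R_1^2+R_2^2)(350R_1^2R_2^2-143(R_1^4+R_2^4))}{82944R_1^7R_2^7}$,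 $b_4=\frac{35(2015(R_1^9+R_2^9)-4131(R_1^7R_2^2+R_1^2R_2^7))}{17496R_1^7R_2^7}$, $b_5=\frac{1225(1700(R_1^6R_2^2+R_1^2R_2^6)+882R_1^4R_2^4-1885(R_1^8+R_2^8))}{497664R_1^7R_2^7}$, $b_6=\frac{455(R_1^7+R_2^7)}{144R_1^7R_2^7}$, $b_7=\frac{245(R_1^2+R_2^2)(554R_1^2R_2^2-1625(R_1^4+R_2^4))}{373248R_1^7R_2^7}$, $b_9=\frac{35(455(R_1^4+R_2^4)+578R_1^2R_2^2)}{165888R_1^7R_2^7}$, $b_{11}=-\frac{7735(R_1^2+R_2^2)}{746496R_1^7R_2^7}$, $b_{13}=\frac{29575}{49268736R_1^7R_2^7}$. (s4) $a_2=\frac{3}{R_2^3}$; $b_1=-\frac{9(R_2^2-R_1^2)^2}{16R_1^3R_2^3}$, $b_2=\frac{3(R_1^3+R_2^3)}{2R_1^3R_2^3}$, $b_3=-\frac{9(R_1^2+R_2^2)}{8R_1^3R_2^3}$, $b_5=\frac{3}{16R_1^3R_2^3}$. -/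

import Mathlib

open MeasureTheory ProbabilityTheory

noncomputable section

namespace Internodal

/-- Three-dimensional Euclidean space. -/
abbrev E3 : Type := EuclideanSpace ℝ (Fin 3)

/-- The four deployment scenarios; node 1 lives in the ball of radius `R₁`,
node 2 in the concentric ball of radius `R₂`. -/
inductive Scenario
  /-- node 1 mobile, node 2 static -/
  | s1
  /-- node 1 static, node 2 mobile -/
  | s2
  /-- both nodes mobile -/
  | s3
  /-- both nodes static -/
  | s4

/-- Law of a static node: the uniform distribution on the ball of radius `R` about the origin. -/
def staticLaw (R : ℝ) : Measure E3 :=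
  ProbabilityTheory.cond (volume : Measure E3) (Metric.closedBall (0 : E3) R)

/-- Spatial density of a random waypoint node in the ball of radius `R` about the origin. With
`ρ = ‖x‖`, multiplying by the area `4 π ρ ^ 2` of the sphere of radius `ρ` gives the radial density
`35 / 72 * (21 * ρ ^ 2 / R ^ 3 - 34 * ρ ^ 4 / R ^ 5 + 13 * ρ ^ 6 / R ^ 7)`, `0 ≤ ρ ≤ R`. -/
def rwpDensity (R : ℝ) (x : E3) : ℝ :=
  (Metric.closedBall (0 : E3) R).indicator
    (fun x => 35 / (288 * Real.pi) *
      (21 / R ^ 3 - 34 * ‖x‖ ^ 2 / R ^ 5 + 13 * ‖x‖ ^ 4 / R ^ 7)) x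

/-- Law of a mobile (random waypoint) node in the ball of radius `R` about the origin. -/
def mobileLaw (R : ℝ) : Measure E3 :=
  (volume : Measure E3).withDensity (fun x => ENNReal.ofReal (rwpDensity R x))

/-- Law of the position of node 1, confined to the ball of radius `R₁`. -/
def nodeLaw₁ (s : Scenario) (R₁ : ℝ) : Measure E3 :=
  match s with
  | .s1 => mobileLaw R₁
  | .s2 => staticLaw R₁
  | .s3 => mobileLaw R₁
  | .s4 => staticLaw R₁

/-- Law of the position of node 2, confined to the ball of radius `R₂`. -/
def nodeLaw₂ (s : Scenario) (R₂ : ℝ) : Measure E3 :=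
  match s with
  | .s1 => staticLaw R₂
  | .s2 => mobileLaw R₂
  | .s3 => mobileLaw R₂
  | .s4 => staticLaw R₂

/-- The coefficients `a₂, a₄, a₆` (the value at other indices is not used). -/
def a (s : Scenario) (R₁ R₂ : ℝ) (n : ℕ) : ℝ :=
  match s, n with
  | .s1, 2 => 3 / R₂ ^ 3
  | .s4, 2 => 3 / R₂ ^ 3
  | .s2, 2 => (65 * R₁ ^ 4 - 238 * R₁ ^ 2 * R₂ ^ 2 + 245 * R₂ ^ 4) / (24 * R₂ ^ 7)
  | .s2, 4 => 35 * (13 * R₁ ^ 2 - 17 * R₂ ^ 2) / (36 * R₂ ^ 7)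
  | .s2, 6 => 455 / (72 * R₂ ^ 7)
  | .s3, 2 => 35 * (2275 * R₁ ^ 4 - 11594 * R₁ ^ 2 * R₂ ^ 2 + 18711 * R₂ ^ 4) / (64152 * R₂ ^ 7)
  | .s3, 4 => 35 * (2015 * R₁ ^ 2 - 4131 * R₂ ^ 2) / (8748 * R₂ ^ 7)
  | .s3, 6 => 455 / (72 * R₂ ^ 7)
  | _, _ => 0

/-- The coefficients `b₁, …, b₁₃` (the value at other indices is not used). In every scenario
`b₈ = b₁₀ = b₁₂ = 0`; in scenarios 1 and 2 also `b₁₁ = b₁₃ = 0`, and in scenario 4 also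
`b₄ = b₆ = b₇ = b₉ = b₁₁ = b₁₃ = 0`. -/
def b (s : Scenario) (R₁ R₂ : ℝ) (n : ℕ) : ℝ :=
  match s, n with
  | .s1, 1 => 35 * (29 * R₁ ^ 2 - 13 * R₂ ^ 2) * (R₂ ^ 2 - R₁ ^ 2) ^ 3 / (2304 * R₁ ^ 7 * R₂ ^ 3)
  | .s1, 2 => (72 * R₁ ^ 7 + 245 * R₁ ^ 4 * R₂ ^ 3 - 238 * R₁ ^ 2 * R₂ ^ 5 + 65 * R₂ ^ 7) /
      (48 * R₁ ^ 7 * R₂ ^ 3)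
  | .s1, 3 => 35 * (R₂ ^ 2 - R₁ ^ 2) * (25 * R₁ ^ 4 + 88 * R₁ ^ 2 * R₂ ^ 2 - 65 * R₂ ^ 4) /
      (576 * R₁ ^ 7 * R₂ ^ 3)
  | .s1, 4 => 35 * (13 * R₂ ^ 2 - 17 * R₁ ^ 2) / (72 * R₁ ^ 7)
  | .s1, 5 => 35 * (7 * R₁ ^ 4 + 34 * R₁ ^ 2 * R₂ ^ 2 - 65 * R₂ ^ 4) / (384 * R₁ ^ 7 * R₂ ^ 3)
  | .s1, 6 => 455 / (144 * R₁ ^ 7)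
  | .s1, 7 => -(7 * (17 * R₁ ^ 2 + 65 * R₂ ^ 2) / (576 * R₁ ^ 7 * R₂ ^ 3))
  | .s1, 9 => 65 / (2304 * R₁ ^ 7 * R₂ ^ 3)
  | .s2, 1 => 35 * (13 * R₁ ^ 2 - 29 * R₂ ^ 2) * (R₂ ^ 2 - R₁ ^ 2) ^ 3 / (2304 * R₂ ^ 7 * R₁ ^ 3)
  | .s2, 2 => (72 * R₂ ^ 7 + 245 * R₂ ^ 4 * R₁ ^ 3 - 238 * R₂ ^ 2 * R₁ ^ 5 + 65 * R₁ ^ 7) /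
      (48 * R₂ ^ 7 * R₁ ^ 3)
  | .s2, 3 => 35 * (R₂ ^ 2 - R₁ ^ 2) * (65 * R₁ ^ 4 - 25 * R₂ ^ 4 - 88 * R₂ ^ 2 * R₁ ^ 2) /
      (576 * R₂ ^ 7 * R₁ ^ 3)
  | .s2, 4 => 35 * (13 * R₁ ^ 2 - 17 * R₂ ^ 2) / (72 * R₂ ^ 7)
  | .s2, 5 => 35 * (7 * R₂ ^ 4 + 34 * R₂ ^ 2 * R₁ ^ 2 - 65 * R₁ ^ 4) / (384 * R₂ ^ 7 * R₁ ^ 3)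
  | .s2, 6 => 455 / (144 * R₂ ^ 7)
  | .s2, 7 => -(7 * (17 * R₂ ^ 2 + 65 * R₁ ^ 2) / (576 * R₂ ^ 7 * R₁ ^ 3))
  | .s2, 9 => 65 / (2304 * R₂ ^ 7 * R₁ ^ 3)
  | .s3, 1 => 245 * (R₂ ^ 2 - R₁ ^ 2) ^ 4 *
      (1442 * R₁ ^ 2 * R₂ ^ 2 - 481 * (R₁ ^ 4 + R₂ ^ 4)) / (1492992 * R₁ ^ 7 * R₂ ^ 7)
  | .s3, 2 => 35 * (2275 * (R₁ ^ 11 + R₂ ^ 11) - 11594 * (R₁ ^ 9 * R₂ ^ 2 + R₁ ^ 2 * R₂ ^ 9) +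
      18711 * (R₁ ^ 7 * R₂ ^ 4 + R₁ ^ 4 * R₂ ^ 7)) / (128304 * R₁ ^ 7 * R₂ ^ 7)
  | .s3, 3 => 1225 * (R₂ ^ 2 - R₁ ^ 2) ^ 2 * (R₁ ^ 2 + R₂ ^ 2) *
      (350 * R₁ ^ 2 * R₂ ^ 2 - 143 * (R₁ ^ 4 + R₂ ^ 4)) / (82944 * R₁ ^ 7 * R₂ ^ 7)
  | .s3, 4 => 35 * (2015 * (R₁ ^ 9 + R₂ ^ 9) - 4131 * (R₁ ^ 7 * R₂ ^ 2 + R₁ ^ 2 * R₂ ^ 7)) /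
      (17496 * R₁ ^ 7 * R₂ ^ 7)
  | .s3, 5 => 1225 * (1700 * (R₁ ^ 6 * R₂ ^ 2 + R₁ ^ 2 * R₂ ^ 6) + 882 * R₁ ^ 4 * R₂ ^ 4 -
      1885 * (R₁ ^ 8 + R₂ ^ 8)) / (497664 * R₁ ^ 7 * R₂ ^ 7)
  | .s3, 6 => 455 * (R₁ ^ 7 + R₂ ^ 7) / (144 * R₁ ^ 7 * R₂ ^ 7)
  | .s3, 7 => 245 * (R₁ ^ 2 + R₂ ^ 2) * (554 * R₁ ^ 2 * R₂ ^ 2 - 1625 * (R₁ ^ 4 + R₂ ^ 4)) /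
      (373248 * R₁ ^ 7 * R₂ ^ 7)
  | .s3, 9 => 35 * (455 * (R₁ ^ 4 + R₂ ^ 4) + 578 * R₁ ^ 2 * R₂ ^ 2) /
      (165888 * R₁ ^ 7 * R₂ ^ 7)
  | .s3, 11 => -(7735 * (R₁ ^ 2 + R₂ ^ 2) / (746496 * R₁ ^ 7 * R₂ ^ 7))
  | .s3, 13 => 29575 / (49268736 * R₁ ^ 7 * R₂ ^ 7)
  | .s4, 1 => -(9 * (R₂ ^ 2 - R₁ ^ 2) ^ 2 / (16 * R₁ ^ 3 * R₂ ^ 3))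
  | .s4, 2 => 3 * (R₁ ^ 3 + R₂ ^ 3) / (2 * R₁ ^ 3 * R₂ ^ 3)
  | .s4, 3 => -(9 * (R₁ ^ 2 + R₂ ^ 2) / (8 * R₁ ^ 3 * R₂ ^ 3))
  | .s4, 5 => 3 / (16 * R₁ ^ 3 * R₂ ^ 3)
  | _, _ => 0

open Classical in
/-- The piecewise polynomial density of the internodal distance (zero off `[0, R₁ + R₂]`). -/
def distDensity (s : Scenario) (R₁ R₂ r : ℝ) : ℝ :=
  if 0 ≤ r ∧ r < R₂ - R₁ then
    ∑ n ∈ Finset.Icc 1 3, a s R₁ R₂ (2 * n) * r ^ (2 * n)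
  else if R₂ - R₁ ≤ r ∧ r ≤ R₁ + R₂ then
    ∑ n ∈ Finset.Icc 1 13, b s R₁ R₂ n * r ^ n
  else 0

end Internodal

end

/-!
The distance `‖x - y‖` of two independent isotropic points is a one-dimensional problem. Translating
`y = x - z` turns its law into the radial law of `z` under the density
`h z = ∫ w₁ ‖x‖ w₂ ‖x - z‖ dx`, and `h` is evaluated in bipolar coordinates with foci `0` and `z`
(`lintegral_bipolar`): in cylindrical coordinates about the axis through `z`, two one-dimensional
substitutions show that the norms `ρ = ‖x‖` and `t = ‖x - z‖` are distributed as
`(2 π / ‖z‖) ρ t dρ dt` on the triangle region `|‖z‖ - ρ| < t < ‖z‖ + ρ`.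

Let `p₁` and `p₂` be the two profiles and let `N` be the tail integral `N ρ = ∫ σ p₂ σ` over
`ρ ≤ σ ≤ R₂`. The inner integral over `t` is a difference of two values of the tail, cut off at `R₂`
(`clampedTail`), so the density is
`f r = 8 π² r ∫ ρ p₁ ρ (N (r - ρ) - N (r + ρ)) dρ` over `0 ≤ ρ ≤ R₁` (`map_dist_eq_withDensity`).
Nonnegativity can be read off from this form, since the tail decreases in the absolute value.

Both profiles here are even polynomials, so `N` is even as well, and the two terms combine into
`8 π² r ∫ ρ p₁ ρ N (r - ρ) dρ` over `-R₁ ≤ ρ ≤ R₁`. The cut-off of `N` only removes the part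
`ρ < r - R₂`, which is empty for `r < R₂ - R₁`: this is the reason for the two polynomial pieces
(`isotropicDistDensity_of_lt_sub`, `isotropicDistDensity_of_sub_le`). Their coefficients come from
an explicit antiderivative (`quarticConvPrimitive`), whose increments are compared with the stated
polynomials for each scenario.
-/

namespace Internodal

open Set Metric Module
open scoped ENNReal

/-! ### Polar, cylindrical and bipolar coordinates -/

/-- Integration of a nonnegative radial function in polar coordinates. -/
lemma lintegral_fun_norm_addHaar {E : Type*} [NormedAddCommGroup E] [NormedSpace ℝ E]
    [FiniteDimensional ℝ E] [Nontrivial E] [MeasurableSpace E] [BorelSpace E]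
    (μ : Measure E) [μ.IsAddHaarMeasure] {f : ℝ → ℝ≥0∞} (hf : Measurable f) :
    ∫⁻ x, f ‖x‖ ∂μ =
      finrank ℝ E * μ (ball 0 1) *
        ∫⁻ r in Ioi (0 : ℝ), ENNReal.ofReal (r ^ (finrank ℝ E - 1)) * f r := by
  have hpow : Measurable fun r : Ioi (0 : ℝ) =>
      ENNReal.ofReal ((r : ℝ) ^ (finrank ℝ E - 1)) := by fun_prop
  have hf' : Measurable fun r : Ioi (0 : ℝ) => f r := hf.comp measurable_subtype_coe
  calc
    ∫⁻ x, f ‖x‖ ∂μ = ∫⁻ x : ({0}ᶜ : Set E), f ‖x.1‖ ∂(μ.comap (↑)) := by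
      rw [lintegral_subtype_comap (measurableSet_singleton _).compl fun x ↦ f ‖x‖,
        restrict_compl_singleton]
    _ = ∫⁻ x, f x.2 ∂μ.toSphere.prod (.volumeIoiPow (finrank ℝ E - 1)) := by
      simpa using μ.measurePreserving_homeomorphUnitSphereProd.lintegral_comp_emb
        (Homeomorph.measurableEmbedding _)
        (fun p : sphere (0 : E) 1 × Ioi (0 : ℝ) => f p.2)
    _ = μ.toSphere univ * ∫⁻ r : Ioi (0 : ℝ), f r ∂.volumeIoiPow (finrank ℝ E - 1) := by
      rw [lintegral_prod _ (by fun_prop)]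
      simp [mul_comm]
    _ = _ := by
      rw [Measure.volumeIoiPow, lintegral_withDensity_eq_lintegral_mul _ hpow hf',
        Measure.toSphere_apply_univ]
      congr 1
      exact lintegral_subtype_comap measurableSet_Ioi
        fun r : ℝ => ENNReal.ofReal (r ^ (finrank ℝ E - 1)) * f r

/-- The map `y ↦ (y₀, (y₁, y₂))` splitting off the first coordinate of `ℝ³`. -/
def axisSplit (y : E3) : ℝ × EuclideanSpace ℝ (Fin 2) :=
  (y 0, WithLp.toLp 2 fun j : Fin 2 => y j.succ)

lemma measurePreserving_axisSplit : MeasurePreserving axisSplit := by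
  have h1 := PiLp.volume_preserving_ofLp (Fin 3)
  have h2 := volume_preserving_piFinSuccAbove (fun _ : Fin 3 => ℝ) 0
  have h3 := (MeasurePreserving.id (volume : Measure ℝ)).prod (PiLp.volume_preserving_toLp (Fin 2))
  exact h3.comp (h2.comp h1)

lemma norm_eq_sqrt_axisSplit (y : E3) :
    ‖y‖ = √((axisSplit y).1 ^ 2 + ‖(axisSplit y).2‖ ^ 2) := by
  rw [EuclideanSpace.norm_sq_eq, EuclideanSpace.norm_eq, Fin.sum_univ_succ]
  simp [axisSplit]

/-- The distance to the point at height `ℓ` on the axis, in cylindrical coordinates. -/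
lemma norm_sub_axis_eq_sqrt_axisSplit (y : E3) (ℓ : ℝ) :
    ‖y - EuclideanSpace.single 0 ℓ‖ =
      √(((axisSplit y).1 - ℓ) ^ 2 + ‖(axisSplit y).2‖ ^ 2) := by
  rw [EuclideanSpace.norm_sq_eq, EuclideanSpace.norm_eq, Fin.sum_univ_succ]
  simp [axisSplit]

/-- Integration in cylindrical coordinates. -/
lemma lintegral_axisSplit {H : ℝ → ℝ → ℝ≥0∞} (hH : Measurable (Function.uncurry H)) :
    ∫⁻ y : E3, H (axisSplit y).1 ‖(axisSplit y).2‖ =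
      ∫⁻ u, ENNReal.ofReal (2 * Real.pi) * ∫⁻ s in Ioi (0 : ℝ), ENNReal.ofReal s * H u s := by
  have hm : Measurable fun p : ℝ × EuclideanSpace ℝ (Fin 2) => H p.1 ‖p.2‖ :=
    hH.comp (measurable_fst.prodMk measurable_snd.norm)
  rw [measurePreserving_axisSplit.lintegral_comp hm, Measure.volume_eq_prod,
    lintegral_prod _ hm.aemeasurable]
  refine lintegral_congr fun u => ?_
  rw [lintegral_fun_norm_addHaar volume (f := H u)
    (hH.comp (measurable_const.prodMk measurable_id))]
  congr 1
  · rw [EuclideanSpace.volume_ball_fin_two]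
    simp [ENNReal.ofReal_mul]
  · simp

/-- The substitution `ρ = √(u² + s²)`. -/
lemma lintegral_sqrt_sq_add_sq (u : ℝ) (g : ℝ → ℝ≥0∞) :
    ∫⁻ s in Ioi (0 : ℝ), ENNReal.ofReal s * g (√(u ^ 2 + s ^ 2)) =
      ∫⁻ ρ in Ioi |u|, ENNReal.ofReal ρ * g ρ := by
  have himg : (fun s => √(u ^ 2 + s ^ 2)) '' Ioi 0 = Ioi |u| := by
    ext ρ
    simp only [mem_image, mem_Ioi]
    constructor
    · rintro ⟨s, hs, rfl⟩
      exact Real.lt_sqrt_of_sq_lt (by rw [sq_abs]; nlinarith)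
    · intro h
      have h0 : 0 < ρ := (abs_nonneg u).trans_lt h
      have h1 : u ^ 2 < ρ ^ 2 := by rw [← sq_abs u]; gcongr
      refine ⟨√(ρ ^ 2 - u ^ 2), Real.sqrt_pos.2 (by linarith), ?_⟩
      rw [Real.sq_sqrt (by linarith), add_sub_cancel, Real.sqrt_sq h0.le]
  have hpos : ∀ s ∈ Ioi (0 : ℝ), 0 < u ^ 2 + s ^ 2 := fun s hs => by
    have : 0 < s ^ 2 := pow_pos hs 2
    positivity
  have hder : ∀ s ∈ Ioi (0 : ℝ), HasDerivWithinAt (fun s => √(u ^ 2 + s ^ 2))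
      (s / √(u ^ 2 + s ^ 2)) (Ioi 0) s := fun s hs => by
    have h := (((hasDerivAt_id s).pow 2).const_add (u ^ 2)).sqrt (hpos s hs).ne'
    refine (h.congr_deriv ?_).hasDerivWithinAt
    have := Real.sqrt_pos.2 (hpos s hs)
    simp only [id, Pi.pow_apply]
    field_simp
    simp
  have hinj : InjOn (fun s => √(u ^ 2 + s ^ 2)) (Ioi 0) := fun s hs t ht h => by
    have h2 := (Real.sqrt_inj (hpos s hs).le (hpos t ht).le).1 h
    exact (sq_eq_sq₀ (mem_Ioi.1 hs).le (mem_Ioi.1 ht).le).1 (by linarith)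
  rw [← himg, lintegral_image_eq_lintegral_abs_deriv_mul measurableSet_Ioi hder hinj]
  refine setLIntegral_congr_fun measurableSet_Ioi fun s hs => ?_
  have hs0 : 0 < s := hs
  have hsq := Real.sqrt_pos.2 (hpos s hs)
  rw [← mul_assoc, ← ENNReal.ofReal_mul (abs_nonneg _), abs_of_pos (by positivity),
    div_mul_cancel₀ _ hsq.ne']

/-- The substitution `t² = ρ² - 2 ℓ u + ℓ²`, which turns the height `u` of a point of the sphere of
radius `ρ` into its distance `t` from the point at height `ℓ` on the axis. -/
lemma lintegral_sqrt_law_of_cosines {ρ ℓ : ℝ} (hρ : 0 < ρ) (hℓ : 0 < ℓ) (g : ℝ → ℝ≥0∞) :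
    ∫⁻ u in Ioo (-ρ) ρ, g (√(ρ ^ 2 - 2 * ℓ * u + ℓ ^ 2)) =
      ENNReal.ofReal ℓ⁻¹ * ∫⁻ t in Ioo |ℓ - ρ| (ℓ + ρ), ENNReal.ofReal t * g t := by
  have hsub : Ioo |ℓ - ρ| (ℓ + ρ) ⊆ Ioi 0 := fun t ht => (abs_nonneg _).trans_lt ht.1
  have himg : (fun t => (ρ ^ 2 + ℓ ^ 2 - t ^ 2) / (2 * ℓ)) '' Ioo |ℓ - ρ| (ℓ + ρ) = Ioo (-ρ) ρ := by
    ext u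
    simp only [mem_image, mem_Ioo]
    constructor
    · rintro ⟨t, ⟨h1, h2⟩, rfl⟩
      have h0 : 0 ≤ |ℓ - ρ| := abs_nonneg _
      have h3 : t ^ 2 < (ℓ + ρ) ^ 2 := pow_lt_pow_left₀ h2 (h0.trans h1.le) two_ne_zero
      have h4 : (ℓ - ρ) ^ 2 < t ^ 2 := by rw [← sq_abs (ℓ - ρ)]; gcongr
      constructor
      · rw [lt_div_iff₀ (by positivity)]; nlinarith
      · rw [div_lt_iff₀ (by positivity)]; nlinarith
    · rintro ⟨h1, h2⟩
      have h3 : (ℓ - ρ) ^ 2 < ρ ^ 2 - 2 * ℓ * u + ℓ ^ 2 := by nlinarith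
      have h4 : ρ ^ 2 - 2 * ℓ * u + ℓ ^ 2 < (ℓ + ρ) ^ 2 := by nlinarith
      have h5 : 0 ≤ ρ ^ 2 - 2 * ℓ * u + ℓ ^ 2 := (sq_nonneg _).trans h3.le
      refine ⟨√(ρ ^ 2 - 2 * ℓ * u + ℓ ^ 2), ⟨Real.lt_sqrt_of_sq_lt (by rwa [sq_abs]),
        (Real.sqrt_lt' (by positivity)).2 h4⟩, ?_⟩
      rw [Real.sq_sqrt h5]
      field_simp
      ring
  have hder : ∀ t ∈ Ioo |ℓ - ρ| (ℓ + ρ),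
      HasDerivWithinAt (fun t => (ρ ^ 2 + ℓ ^ 2 - t ^ 2) / (2 * ℓ)) (-(t / ℓ))
        (Ioo |ℓ - ρ| (ℓ + ρ)) t := fun t _ => by
    have h := (((hasDerivAt_id t).pow 2).const_sub (ρ ^ 2 + ℓ ^ 2)).div_const (2 * ℓ)
    refine (h.congr_deriv ?_).hasDerivWithinAt
    simp only [id]
    field_simp
    simp
  have hinj : InjOn (fun t => (ρ ^ 2 + ℓ ^ 2 - t ^ 2) / (2 * ℓ)) (Ioo |ℓ - ρ| (ℓ + ρ)) :=
    fun s hs t ht h => by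
      have h2 := (div_left_inj' (by positivity)).1 h
      exact (sq_eq_sq₀ (mem_Ioi.1 (hsub hs)).le (mem_Ioi.1 (hsub ht)).le).1 (by linarith)
  rw [← himg, lintegral_image_eq_lintegral_abs_deriv_mul measurableSet_Ioo hder hinj,
    ← lintegral_const_mul' _ _ ENNReal.ofReal_ne_top]
  refine setLIntegral_congr_fun measurableSet_Ioo fun t ht => ?_
  have ht0 : 0 < t := hsub ht
  have h1 : ρ ^ 2 - 2 * ℓ * ((ρ ^ 2 + ℓ ^ 2 - t ^ 2) / (2 * ℓ)) + ℓ ^ 2 = t ^ 2 := by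
    field_simp
    ring
  rw [h1, Real.sqrt_sq ht0.le, ← mul_assoc, ← ENNReal.ofReal_mul (by positivity), abs_neg,
    abs_of_pos (by positivity), div_eq_inv_mul]

/-- Integration in bipolar coordinates whose foci are the origin and a point on the axis. -/
lemma lintegral_bipolar_axis {ℓ : ℝ} (hℓ : 0 < ℓ) {F : ℝ → ℝ → ℝ≥0∞}
    (hF : Measurable (Function.uncurry F)) :
    ∫⁻ y : E3, F ‖y‖ ‖y - EuclideanSpace.single 0 ℓ‖ =
      ENNReal.ofReal (2 * Real.pi / ℓ) * ∫⁻ ρ in Ioi (0 : ℝ), ENNReal.ofReal ρ *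
        ∫⁻ t in Ioo |ℓ - ρ| (ℓ + ρ), ENNReal.ofReal t * F ρ t := by
  have hcos : ∀ u s : ℝ, (u - ℓ) ^ 2 + s ^ 2 = √(u ^ 2 + s ^ 2) ^ 2 - 2 * ℓ * u + ℓ ^ 2 :=
    fun u s => by rw [Real.sq_sqrt (by positivity)]; ring
  have hG : Measurable fun p : ℝ × ℝ =>
      ENNReal.ofReal p.2 * F p.2 (√(p.2 ^ 2 - 2 * ℓ * p.1 + ℓ ^ 2)) := by
    refine Measurable.mul (by fun_prop) (hF.comp (Measurable.prodMk (by fun_prop) (by fun_prop)))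
  simp_rw [norm_sub_axis_eq_sqrt_axisSplit, norm_eq_sqrt_axisSplit]
  rw [lintegral_axisSplit (H := fun u s => F (√(u ^ 2 + s ^ 2)) (√((u - ℓ) ^ 2 + s ^ 2)))
    (hF.comp (Measurable.prodMk (by fun_prop) (by fun_prop)))]
  rw [lintegral_const_mul' _ _ ENNReal.ofReal_ne_top]
  simp_rw [hcos]
  -- Writing `|u| < ρ` as an indicator makes the two ranges of integration independent.
  have h1 : ∀ u : ℝ, ∫⁻ s in Ioi (0 : ℝ), ENNReal.ofReal s *
      F (√(u ^ 2 + s ^ 2)) (√(√(u ^ 2 + s ^ 2) ^ 2 - 2 * ℓ * u + ℓ ^ 2)) =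
      ∫⁻ ρ in Ioi (0 : ℝ), (Ioo (-ρ) ρ).indicator (fun u => ENNReal.ofReal ρ *
        F ρ (√(ρ ^ 2 - 2 * ℓ * u + ℓ ^ 2))) u := fun u => by
    rw [lintegral_sqrt_sq_add_sq u fun ρ => F ρ (√(ρ ^ 2 - 2 * ℓ * u + ℓ ^ 2)),
      ← lintegral_indicator measurableSet_Ioi, ← lintegral_indicator measurableSet_Ioi]
    refine lintegral_congr fun ρ => ?_
    by_cases h : |u| < ρ
    · have hu : u ∈ Ioo (-ρ) ρ := abs_lt.1 h
      rw [indicator_of_mem (mem_Ioi.2 h), indicator_of_mem (mem_Ioi.2 ((abs_nonneg u).trans_lt h)),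
        indicator_of_mem hu]
    · rw [indicator_of_notMem (by simpa using h)]
      have hu : u ∉ Ioo (-ρ) ρ := fun h' => h (abs_lt.2 h')
      by_cases h0 : 0 < ρ
      · rw [indicator_of_mem (mem_Ioi.2 h0), indicator_of_notMem hu]
      · rw [indicator_of_notMem (by simpa using h0)]
  simp_rw [h1]
  rw [lintegral_lintegral_swap]
  · rw [div_eq_mul_inv, ENNReal.ofReal_mul (by positivity : 0 ≤ 2 * Real.pi), mul_assoc,
      ← lintegral_const_mul' (ENNReal.ofReal ℓ⁻¹) _ ENNReal.ofReal_ne_top]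
    congr 1
    refine setLIntegral_congr_fun measurableSet_Ioi fun ρ hρ => ?_
    rw [lintegral_indicator measurableSet_Ioo, lintegral_const_mul' _ _ ENNReal.ofReal_ne_top,
      lintegral_sqrt_law_of_cosines hρ hℓ]
    ring
  · have hS : MeasurableSet {p : ℝ × ℝ | p.1 ∈ Ioo (-p.2) p.2} :=
      MeasurableSet.inter
        (measurableSet_lt (f := fun p : ℝ × ℝ => -p.2) (by fun_prop) (by fun_prop))
        (measurableSet_lt (f := fun p : ℝ × ℝ => p.1) (by fun_prop) (by fun_prop))
    exact (hG.indicator hS).aemeasurable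

/-- **Bipolar coordinates**: integration of a nonnegative function of the distances of `y` from the
two foci `0` and `z`. -/
lemma lintegral_bipolar {z : E3} (hz : z ≠ 0) {F : ℝ → ℝ → ℝ≥0∞}
    (hF : Measurable (Function.uncurry F)) :
    ∫⁻ y : E3, F ‖y‖ ‖y - z‖ =
      ENNReal.ofReal (2 * Real.pi / ‖z‖) * ∫⁻ ρ in Ioi (0 : ℝ), ENNReal.ofReal ρ *
        ∫⁻ t in Ioo |‖z‖ - ρ| (‖z‖ + ρ), ENNReal.ofReal t * F ρ t := by
  have hz' : ‖z‖ ≠ 0 := norm_ne_zero_iff.2 hz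
  -- An orthonormal basis whose first vector points along `z` moves `z` onto the axis.
  obtain ⟨b, hb⟩ := Orthonormal.exists_orthonormalBasis_extension_of_card_eq (𝕜 := ℝ) (E := E3)
    (ι := Fin 3) (by simp) (v := fun _ => ‖z‖⁻¹ • z) (s := {0})
    ⟨fun i => by simp [norm_smul, hz'], fun i j hij => (hij (Subsingleton.elim i j)).elim⟩
  have hrepr : b.repr z = EuclideanSpace.single 0 ‖z‖ := by
    have h0 : z = ‖z‖ • b 0 := by rw [hb 0 rfl, smul_smul, mul_inv_cancel₀ hz', one_smul]
    conv_lhs => rw [h0, map_smul, b.repr_self]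
    ext i
    simp
  rw [← lintegral_bipolar_axis (norm_pos_iff.2 hz) hF,
    ← b.measurePreserving_repr.lintegral_comp_emb b.repr.toHomeomorph.measurableEmbedding
      fun y => F ‖y‖ ‖y - EuclideanSpace.single 0 ‖z‖‖]
  refine lintegral_congr fun y => ?_
  rw [← hrepr, ← map_sub, b.repr.norm_map, b.repr.norm_map]

/-- Distribution of the distance between two points of `ℝ³` that carry the isotropic densities
`w₁ ‖x‖` and `w₂ ‖y‖`. -/
lemma lintegral_lintegral_dist {G w₁ w₂ : ℝ → ℝ≥0∞} (hG : Measurable G) (h₁ : Measurable w₁)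
    (h₂ : Measurable w₂) :
    ∫⁻ x : E3, ∫⁻ y : E3, G (dist x y) * (w₁ ‖x‖ * w₂ ‖y‖) =
      ∫⁻ r in Ioi (0 : ℝ), G r * (ENNReal.ofReal (8 * Real.pi ^ 2 * r) *
        ∫⁻ ρ in Ioi (0 : ℝ), ENNReal.ofReal ρ * w₁ ρ *
          ∫⁻ t in Ioo |r - ρ| (r + ρ), ENNReal.ofReal t * w₂ t) := by
  have hF : Measurable (Function.uncurry fun ρ t => w₁ ρ * w₂ t) :=
    (h₁.comp measurable_fst).mul (h₂.comp measurable_snd)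
  have hm : Measurable fun p : E3 × E3 => G ‖p.2‖ * (w₁ ‖p.1‖ * w₂ ‖p.1 - p.2‖) := by fun_prop
  have hI : Measurable fun r : ℝ => ∫⁻ ρ in Ioi (0 : ℝ), ENNReal.ofReal ρ * w₁ ρ *
      ∫⁻ t in Ioo |r - ρ| (r + ρ), ENNReal.ofReal t * w₂ t := by
    have hS : MeasurableSet {q : (ℝ × ℝ) × ℝ | q.2 ∈ Ioo |q.1.1 - q.1.2| (q.1.1 + q.1.2)} :=
      MeasurableSet.inter
        (measurableSet_lt (f := fun q : (ℝ × ℝ) × ℝ => |q.1.1 - q.1.2|) (by fun_prop) (by fun_prop))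
        (measurableSet_lt (f := fun q : (ℝ × ℝ) × ℝ => q.2) (by fun_prop) (by fun_prop))
    have h3 : Measurable fun q : (ℝ × ℝ) × ℝ => ENNReal.ofReal q.2 * w₂ q.2 := by fun_prop
    have h4 : Measurable fun p : ℝ × ℝ =>
        ∫⁻ t in Ioo |p.1 - p.2| (p.1 + p.2), ENNReal.ofReal t * w₂ t := by
      simp_rw [← lintegral_indicator measurableSet_Ioo]
      exact (h3.indicator hS).lintegral_prod_right'
    exact Measurable.lintegral_prod_right' (f := fun p : ℝ × ℝ => ENNReal.ofReal p.2 * w₁ p.2 *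
      ∫⁻ t in Ioo |p.1 - p.2| (p.1 + p.2), ENNReal.ofReal t * w₂ t) (by fun_prop)
  calc
    _ = ∫⁻ x : E3, ∫⁻ z : E3, G ‖z‖ * (w₁ ‖x‖ * w₂ ‖x - z‖) := by
      refine lintegral_congr fun x => ?_
      rw [← lintegral_sub_left_eq_self _ x]
      simp
    _ = ∫⁻ z : E3, G ‖z‖ * ∫⁻ x : E3, w₁ ‖x‖ * w₂ ‖x - z‖ := by
      rw [lintegral_lintegral_swap hm.aemeasurable]
      refine lintegral_congr fun z => ?_
      rw [lintegral_const_mul _ (by fun_prop)]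
    _ = ∫⁻ z : E3, G ‖z‖ * (ENNReal.ofReal (2 * Real.pi / ‖z‖) *
          ∫⁻ ρ in Ioi (0 : ℝ), ENNReal.ofReal ρ * w₁ ρ *
            ∫⁻ t in Ioo |‖z‖ - ρ| (‖z‖ + ρ), ENNReal.ofReal t * w₂ t) := by
      have hae : ∀ᵐ z : E3, z ≠ 0 := by simp [ae_iff]
      refine lintegral_congr_ae (hae.mono fun z hz => ?_)
      simp only
      rw [lintegral_bipolar hz hF]
      congr 2
      refine lintegral_congr fun ρ => ?_
      simp_rw [mul_left_comm _ (w₁ ρ)]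
      rw [lintegral_const_mul _ (by fun_prop)]
      ring
    _ = _ := by
      rw [lintegral_fun_norm_addHaar volume (f := fun r => G r * (ENNReal.ofReal (2 * Real.pi / r) *
          ∫⁻ ρ in Ioi (0 : ℝ), ENNReal.ofReal ρ * w₁ ρ *
            ∫⁻ t in Ioo |r - ρ| (r + ρ), ENNReal.ofReal t * w₂ t)) (by fun_prop),
        ← lintegral_const_mul _ (by fun_prop)]
      refine setLIntegral_congr_fun measurableSet_Ioi fun r hr => ?_
      have hr0 : 0 < r := hr
      have hball : (finrank ℝ E3 : ℝ≥0∞) * volume (ball (0 : E3) 1) =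
          ENNReal.ofReal (4 * Real.pi) := by
        rw [EuclideanSpace.volume_ball_fin_three, finrank_euclideanSpace_fin,
          ← ENNReal.ofReal_natCast, ENNReal.ofReal_one, one_pow, one_mul,
          ← ENNReal.ofReal_mul (by positivity)]
        congr 1
        push_cast
        ring
      have hconst : ENNReal.ofReal (8 * Real.pi ^ 2 * r) = ENNReal.ofReal (4 * Real.pi) *
          ENNReal.ofReal (r ^ 2) * ENNReal.ofReal (2 * Real.pi / r) := by
        rw [← ENNReal.ofReal_mul (by positivity), ← ENNReal.ofReal_mul (by positivity)]
        congr 1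
        field_simp
        ring
      simp only [finrank_euclideanSpace_fin] at hball ⊢
      rw [hball, hconst]
      ring

/-! ### The distance of two isotropic points -/

/-- The isotropic measure on the ball of radius `R` with spatial density `p ‖x‖`. -/
noncomputable def isotropicLaw (p : ℝ → ℝ) (R : ℝ) : Measure E3 :=
  volume.withDensity fun x => ENNReal.ofReal ((Iic R).indicator p ‖x‖)

/-- The even extension of `ρ ↦ N (min ρ R)`. When `N ρ = ∫ σ in ρ..R, σ * p σ`, this is the tail
integral of `σ * p σ` for a profile `p` cut off at `R`. -/
def clampedTail (N : ℝ → ℝ) (R x : ℝ) : ℝ := N (min |x| R)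

/-- The distance density: up to `8 π²`, `r` times the tail of the second profile integrated
against the first one. The two tails come from the range `|r - ρ| < t < r + ρ` of the norm `t` of
the second point, given the norm `ρ` of the first. -/
noncomputable def isotropicDistDensity (p N : ℝ → ℝ) (R₁ R₂ r : ℝ) : ℝ :=
  8 * Real.pi ^ 2 * r * ∫ ρ in (0 : ℝ)..R₁,
    ρ * p ρ * (clampedTail N R₂ (r - ρ) - clampedTail N R₂ (r + ρ))

lemma continuous_clampedTail {N : ℝ → ℝ} (hN : Continuous N) (R : ℝ) :
    Continuous (clampedTail N R) :=
  hN.comp (continuous_abs.min continuous_const)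

section Tail

variable {p N : ℝ → ℝ} {R : ℝ}

lemma integral_eq_tail_sub (hp : Continuous p) (hN : ∀ x, HasDerivAt N (-(x * p x)) x) (a b : ℝ) :
    ∫ t in a..b, t * p t = N a - N b := by
  have h := intervalIntegral.integral_eq_sub_of_hasDerivAt (a := a) (b := b)
    (f := fun x => -N x) (f' := fun x => x * p x)
    (fun x _ => (hN x).neg.congr_deriv (neg_neg _))
    ((continuous_id.mul hp).intervalIntegrable _ _)
  rw [h]
  ring

lemma tail_sub_nonneg (hp : Continuous p) (hp0 : ∀ x ∈ Icc 0 R, 0 ≤ p x) (hR : 0 ≤ R)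
    (hN : ∀ x, HasDerivAt N (-(x * p x)) x) {a b : ℝ} (ha : 0 ≤ a) (hab : a ≤ b) :
    0 ≤ N (min a R) - N (min b R) := by
  rw [← integral_eq_tail_sub hp hN]
  refine intervalIntegral.integral_nonneg (min_le_min_right _ hab) fun t ht => ?_
  have h0 : 0 ≤ t := (le_min ha hR).trans ht.1
  exact mul_nonneg h0 (hp0 t ⟨h0, ht.2.trans (min_le_right _ _)⟩)

lemma clampedTail_sub_nonneg (hp : Continuous p) (hp0 : ∀ x ∈ Icc 0 R, 0 ≤ p x) (hR : 0 ≤ R)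
    (hN : ∀ x, HasDerivAt N (-(x * p x)) x) {r ρ : ℝ} (hr : 0 ≤ r) (hρ : 0 ≤ ρ) :
    0 ≤ clampedTail N R (r - ρ) - clampedTail N R (r + ρ) := by
  refine tail_sub_nonneg hp hp0 hR hN (abs_nonneg _) ?_
  rw [abs_of_nonneg (add_nonneg hr hρ)]
  exact abs_le.2 ⟨by linarith, by linarith⟩

/-- The cut-off of the profile at `R` amounts to clamping both arguments of the tail. -/
lemma setLIntegral_indicator_eq_tail_sub (hp : Continuous p) (hp0 : ∀ x ∈ Icc 0 R, 0 ≤ p x)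
    (hR : 0 ≤ R) (hN : ∀ x, HasDerivAt N (-(x * p x)) x) {a b : ℝ} (ha : 0 ≤ a) (hab : a ≤ b) :
    ∫⁻ t in Ioo a b, ENNReal.ofReal t * ENNReal.ofReal ((Iic R).indicator p t) =
      ENNReal.ofReal (N (min a R) - N (min b R)) := by
  have hset : Ioc (min a R) (min b R) = Ioc a b ∩ Iic R := by
    ext t
    simp only [mem_Ioc, mem_inter_iff, mem_Iic, le_min_iff, min_lt_iff]
    constructor
    · rintro ⟨h1 | h1, h2, h3⟩
      · exact ⟨⟨h1, h2⟩, h3⟩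
      · exact (h1.not_ge h3).elim
    · rintro ⟨⟨h1, h2⟩, h3⟩
      exact ⟨Or.inl h1, h2, h3⟩
  rw [← integral_eq_tail_sub hp hN, intervalIntegral.integral_of_le (min_le_min_right _ hab),
    ofReal_integral_eq_lintegral_ofReal (Continuous.integrableOn_Ioc (by fun_prop))]
  · rw [hset, inter_comm, ← Measure.restrict_restrict measurableSet_Iic,
      ← lintegral_indicator measurableSet_Iic, Measure.restrict_congr_set Ioo_ae_eq_Ioc]
    refine setLIntegral_congr_fun measurableSet_Ioc fun t ht => ?_
    by_cases h : t ≤ R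
    · rw [indicator_of_mem (mem_Iic.2 h), indicator_of_mem (mem_Iic.2 h),
        ENNReal.ofReal_mul (ha.trans ht.1.le)]
    · rw [indicator_of_notMem (by simpa using h), indicator_of_notMem (by simpa using h)]
      simp
  · filter_upwards [ae_restrict_mem measurableSet_Ioc] with t ht
    have h0 : 0 ≤ t := (le_min ha hR).trans ht.1.le
    exact mul_nonneg h0 (hp0 t ⟨h0, ht.2.trans (min_le_right _ _)⟩)

end Tail

section Isotropic

variable {p₁ p₂ N : ℝ → ℝ} {R₁ R₂ r : ℝ}

lemma isotropicDistDensity_nonneg (hp₁0 : ∀ x ∈ Icc 0 R₁, 0 ≤ p₁ x)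
    (hp₂ : Continuous p₂) (hp₂0 : ∀ x ∈ Icc 0 R₂, 0 ≤ p₂ x) (hR₁ : 0 ≤ R₁) (hR₂ : 0 ≤ R₂)
    (hN : ∀ x, HasDerivAt N (-(x * p₂ x)) x) (hr : 0 ≤ r) :
    0 ≤ isotropicDistDensity p₁ N R₁ R₂ r :=
  mul_nonneg (by positivity) <| intervalIntegral.integral_nonneg hR₁ fun ρ hρ =>
    mul_nonneg (mul_nonneg hρ.1 (hp₁0 ρ hρ)) (clampedTail_sub_nonneg hp₂ hp₂0 hR₂ hN hr hρ.1)

/-- The iterated integral of `lintegral_lintegral_dist` for cut-off profiles, as a Bochner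
integral. -/
lemma ofReal_isotropicDistDensity (hp₁ : Continuous p₁) (hp₁0 : ∀ x ∈ Icc 0 R₁, 0 ≤ p₁ x)
    (hp₂ : Continuous p₂) (hp₂0 : ∀ x ∈ Icc 0 R₂, 0 ≤ p₂ x) (hR₁ : 0 ≤ R₁) (hR₂ : 0 ≤ R₂)
    (hN : ∀ x, HasDerivAt N (-(x * p₂ x)) x) (hr : 0 ≤ r) :
    ENNReal.ofReal (8 * Real.pi ^ 2 * r) *
        ∫⁻ ρ in Ioi (0 : ℝ), ENNReal.ofReal ρ * ENNReal.ofReal ((Iic R₁).indicator p₁ ρ) *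
          ∫⁻ t in Ioo |r - ρ| (r + ρ), ENNReal.ofReal t *
            ENNReal.ofReal ((Iic R₂).indicator p₂ t) =
      ENNReal.ofReal (isotropicDistDensity p₁ N R₁ R₂ r) := by
  have hNc : Continuous N := continuous_iff_continuousAt.2 fun x => (hN x).continuousAt
  have hT := continuous_clampedTail hNc R₂
  rw [isotropicDistDensity, ENNReal.ofReal_mul (p := 8 * Real.pi ^ 2 * r) (by positivity),
    intervalIntegral.integral_of_le hR₁, ofReal_integral_eq_lintegral_ofReal]
  · congr 1
    rw [← Ioi_inter_Iic, inter_comm, ← Measure.restrict_restrict measurableSet_Iic,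
      ← lintegral_indicator measurableSet_Iic]
    refine setLIntegral_congr_fun measurableSet_Ioi fun ρ hρ => ?_
    have hρ0 : 0 < ρ := hρ
    by_cases h : ρ ≤ R₁
    · rw [indicator_of_mem (mem_Iic.2 h), indicator_of_mem (mem_Iic.2 h),
        setLIntegral_indicator_eq_tail_sub hp₂ hp₂0 hR₂ hN (abs_nonneg _)
          (abs_le.2 ⟨by linarith, by linarith⟩), ← ENNReal.ofReal_mul hρ0.le,
        ← ENNReal.ofReal_mul (mul_nonneg hρ0.le (hp₁0 ρ ⟨hρ0.le, h⟩)), clampedTail, clampedTail,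
        abs_of_nonneg (add_nonneg hr hρ0.le)]
    · rw [indicator_of_notMem (by simpa using h), indicator_of_notMem (by simpa using h)]
      simp
  · exact Continuous.integrableOn_Ioc (by fun_prop)
  · filter_upwards [ae_restrict_mem measurableSet_Ioc] with ρ hρ
    exact mul_nonneg (mul_nonneg hρ.1.le (hp₁0 ρ (Ioc_subset_Icc_self hρ)))
      (clampedTail_sub_nonneg hp₂ hp₂0 hR₂ hN hr hρ.1.le)

/-- The distance of two independent points with isotropic laws has the law given by
`isotropicDistDensity`. -/
theorem map_dist_eq_withDensity {Ω : Type*} [MeasurableSpace Ω] {P : Measure Ω}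
    [IsProbabilityMeasure P] {X Y : Ω → E3} (hX : HasLaw X (isotropicLaw p₁ R₁) P)
    (hY : HasLaw Y (isotropicLaw p₂ R₂) P) (hXY : IndepFun X Y P)
    (hp₁ : Continuous p₁) (hp₁0 : ∀ x ∈ Icc 0 R₁, 0 ≤ p₁ x)
    (hp₂ : Continuous p₂) (hp₂0 : ∀ x ∈ Icc 0 R₂, 0 ≤ p₂ x) (hR₁ : 0 ≤ R₁) (hR₂ : 0 ≤ R₂)
    (hN : ∀ x, HasDerivAt N (-(x * p₂ x)) x) :
    P.map (fun ω => dist (X ω) (Y ω)) = (volume : Measure ℝ).withDensity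
      ((Ici 0).indicator fun r => ENNReal.ofReal (isotropicDistDensity p₁ N R₁ R₂ r)) := by
  have hw₁ : Measurable fun t => ENNReal.ofReal ((Iic R₁).indicator p₁ t) :=
    (hp₁.measurable.indicator measurableSet_Iic).ennreal_ofReal
  have hw₂ : Measurable fun t => ENNReal.ofReal ((Iic R₂).indicator p₂ t) :=
    (hp₂.measurable.indicator measurableSet_Iic).ennreal_ofReal
  have hw : Measurable fun q : E3 × E3 => ENNReal.ofReal ((Iic R₁).indicator p₁ ‖q.1‖) *
      ENNReal.ofReal ((Iic R₂).indicator p₂ ‖q.2‖) :=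
    (hw₁.comp measurable_fst.norm).mul (hw₂.comp measurable_snd.norm)
  have hlaw : P.map (fun ω => (X ω, Y ω)) = (volume.prod volume).withDensity fun q : E3 × E3 =>
      ENNReal.ofReal ((Iic R₁).indicator p₁ ‖q.1‖) *
        ENNReal.ofReal ((Iic R₂).indicator p₂ ‖q.2‖) := by
    rw [(indepFun_iff_map_prod_eq_prod_map_map hX.aemeasurable hY.aemeasurable).1 hXY,
      hX.map_eq, hY.map_eq, isotropicLaw, isotropicLaw]
    exact prod_withDensity (hw₁.comp measurable_norm) (hw₂.comp measurable_norm)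
  have hdist : Measurable fun q : E3 × E3 => dist q.1 q.2 := measurable_dist
  have hmap : P.map (fun ω => dist (X ω) (Y ω)) =
      (P.map fun ω => (X ω, Y ω)).map fun q : E3 × E3 => dist q.1 q.2 :=
    (AEMeasurable.map_map_of_aemeasurable hdist.aemeasurable
      (hX.aemeasurable.prodMk hY.aemeasurable)).symm
  ext S hS
  have hG : Measurable (S.indicator (1 : ℝ → ℝ≥0∞)) := measurable_one.indicator hS
  have hGd : Measurable fun q : E3 × E3 => S.indicator (1 : ℝ → ℝ≥0∞) (dist q.1 q.2) :=
    hG.comp hdist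
  rw [hmap, hlaw, ← lintegral_indicator_one hS, lintegral_map hG hdist,
    lintegral_withDensity_eq_lintegral_mul _ hw hGd,
    lintegral_prod _ (hw.mul hGd).aemeasurable]
  have key := lintegral_lintegral_dist hG hw₁ hw₂
  simp only [Pi.mul_apply] at key ⊢
  calc
    _ = _ := by
      refine Eq.trans ?_ key
      refine lintegral_congr fun x => lintegral_congr fun y => ?_
      rw [mul_comm]
    _ = ∫⁻ r in Ioi 0, S.indicator
          (fun r => ENNReal.ofReal (isotropicDistDensity p₁ N R₁ R₂ r)) r := by
      refine setLIntegral_congr_fun measurableSet_Ioi fun r hr => ?_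
      rw [ofReal_isotropicDistDensity hp₁ hp₁0 hp₂ hp₂0 hR₁ hR₂ hN (mem_Ioi.1 hr).le]
      by_cases h : r ∈ S <;> simp [h]
    _ = _ := by
      rw [Measure.restrict_congr_set Ioi_ae_eq_Ici, withDensity_apply _ hS,
        ← lintegral_indicator measurableSet_Ici, ← lintegral_indicator hS]
      refine lintegral_congr fun r => ?_
      rw [indicator_indicator, indicator_indicator, inter_comm]

/-- For an even profile, the distance density is an integral over a symmetric interval of a single
tail. -/
lemma integral_clampedTail_sub (hp₁ : Continuous p₁) (heven : ∀ x, p₁ (-x) = p₁ x)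
    (hN : Continuous N) (R₁ R₂ r : ℝ) :
    ∫ ρ in (0 : ℝ)..R₁, ρ * p₁ ρ * (clampedTail N R₂ (r - ρ) - clampedTail N R₂ (r + ρ)) =
      ∫ ρ in (-R₁)..R₁, ρ * p₁ ρ * clampedTail N R₂ (r - ρ) := by
  have hT := continuous_clampedTail hN R₂
  have hc : Continuous fun ρ => ρ * p₁ ρ * clampedTail N R₂ (r - ρ) := by fun_prop
  have hc' : Continuous fun ρ => -ρ * p₁ ρ * clampedTail N R₂ (r + ρ) := by fun_prop
  rw [← intervalIntegral.integral_add_adjacent_intervals (hc.intervalIntegrable (-R₁) 0)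
    (hc.intervalIntegrable 0 R₁)]
  have h := intervalIntegral.integral_comp_neg (a := 0) (b := R₁)
    fun ρ => ρ * p₁ ρ * clampedTail N R₂ (r - ρ)
  simp only [heven, sub_neg_eq_add, neg_zero] at h
  rw [← h, ← intervalIntegral.integral_add (hc'.intervalIntegrable _ _)
    (hc.intervalIntegrable _ _)]
  congr 1
  ext ρ
  ring

lemma clampedTail_of_abs_le (hN : ∀ x, N |x| = N x) {x : ℝ} (hx : |x| ≤ R₂) :
    clampedTail N R₂ x = N x := by
  rw [clampedTail, min_eq_left hx, hN]

lemma clampedTail_of_le_abs (hN : N R₂ = 0) {x : ℝ} (hx : R₂ ≤ |x|) : clampedTail N R₂ x = 0 := by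
  rw [clampedTail, min_eq_right hx, hN]

/-- Below `R₂ - R₁` all arguments `r - ρ` of the tail stay in `[-R₂, R₂]`, so that the cut-off has
no effect. -/
lemma isotropicDistDensity_of_lt_sub (hp₁ : Continuous p₁) (heven : ∀ x, p₁ (-x) = p₁ x)
    (hNc : Continuous N) (hN : ∀ x, N |x| = N x) (hR₁ : 0 ≤ R₁) (hr : 0 ≤ r) (h : r < R₂ - R₁) :
    isotropicDistDensity p₁ N R₁ R₂ r =
      8 * Real.pi ^ 2 * r * ∫ ρ in (-R₁)..R₁, ρ * p₁ ρ * N (r - ρ) := by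
  rw [isotropicDistDensity, integral_clampedTail_sub hp₁ heven hNc]
  congr 1
  refine intervalIntegral.integral_congr fun ρ hρ => ?_
  rw [uIcc_of_le (by linarith)] at hρ
  rw [clampedTail_of_abs_le hN (abs_le.2 ⟨by linarith [hρ.2], by linarith [hρ.1]⟩)]

/-- Beyond `R₂ - R₁` the tail vanishes on `[-R₁, r - R₂]`, so that only the lower end of the
interval of integration changes. -/
lemma isotropicDistDensity_of_sub_le (hp₁ : Continuous p₁) (heven : ∀ x, p₁ (-x) = p₁ x)
    (hNc : Continuous N) (hN : ∀ x, N |x| = N x) (hN0 : N R₂ = 0) (hR : R₁ ≤ R₂)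
    (h : R₂ - R₁ ≤ r) (h' : r ≤ R₁ + R₂) :
    isotropicDistDensity p₁ N R₁ R₂ r =
      8 * Real.pi ^ 2 * r * ∫ ρ in (r - R₂)..R₁, ρ * p₁ ρ * N (r - ρ) := by
  have hT := continuous_clampedTail hNc R₂
  have hc : Continuous fun ρ => ρ * p₁ ρ * clampedTail N R₂ (r - ρ) := by fun_prop
  have h0 : ∫ ρ in (-R₁)..(r - R₂), ρ * p₁ ρ * clampedTail N R₂ (r - ρ) = 0 := by
    refine (intervalIntegral.integral_congr fun ρ hρ => ?_).trans intervalIntegral.integral_zero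
    rw [uIcc_of_le (by linarith)] at hρ
    rw [clampedTail_of_le_abs hN0 (le_abs.2 (Or.inl (by linarith [hρ.2]))), mul_zero]
  rw [isotropicDistDensity, integral_clampedTail_sub hp₁ heven hNc,
    ← intervalIntegral.integral_add_adjacent_intervals (hc.intervalIntegrable (-R₁) (r - R₂))
      (hc.intervalIntegrable (r - R₂) R₁), h0, zero_add]
  congr 1
  refine intervalIntegral.integral_congr fun ρ hρ => ?_
  rw [uIcc_of_le (by linarith)] at hρ
  rw [clampedTail_of_abs_le hN (abs_le.2 ⟨by linarith [hρ.2], by linarith [hρ.1]⟩)]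

lemma isotropicDistDensity_of_add_lt (hp₁ : Continuous p₁) (heven : ∀ x, p₁ (-x) = p₁ x)
    (hNc : Continuous N) (hN0 : N R₂ = 0) (hR₁ : 0 ≤ R₁) (h : R₁ + R₂ < r) :
    isotropicDistDensity p₁ N R₁ R₂ r = 0 := by
  rw [isotropicDistDensity, integral_clampedTail_sub hp₁ heven hNc,
    (intervalIntegral.integral_congr fun ρ hρ => ?_).trans intervalIntegral.integral_zero, mul_zero]
  rw [uIcc_of_le (by linarith)] at hρ
  rw [clampedTail_of_le_abs hN0 (le_abs.2 (Or.inl (by linarith [hρ.2]))), mul_zero]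

end Isotropic

/-! ### Quartic profiles -/

/-- The antiderivative, vanishing at `ρ = 0`, of `ρ ↦ ρ ^ i * (r - ρ) ^ j`. -/
noncomputable def mulSubPowPrimitive (i j : ℕ) (r ρ : ℝ) : ℝ :=
  ∑ k ∈ Finset.range (j + 1),
    (-1) ^ k * r ^ (j - k) * j.choose k * (ρ ^ (i + k + 1) / (i + k + 1 : ℕ))

lemma hasDerivAt_mulSubPowPrimitive (i j : ℕ) (r ρ : ℝ) :
    HasDerivAt (mulSubPowPrimitive i j r) (ρ ^ i * (r - ρ) ^ j) ρ := by
  have h : ∀ k ∈ Finset.range (j + 1), HasDerivAt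
      (fun x : ℝ => (-1) ^ k * r ^ (j - k) * j.choose k * (x ^ (i + k + 1) / (i + k + 1 : ℕ)))
      ((-1) ^ k * r ^ (j - k) * j.choose k * ρ ^ (i + k)) ρ := fun k _ => by
    have h1 := ((hasDerivAt_pow (i + k + 1) ρ).div_const ((i + k + 1 : ℕ) : ℝ)).const_mul
      ((-1) ^ k * r ^ (j - k) * j.choose k)
    refine h1.congr_deriv ?_
    have h2 : ((i + k + 1 : ℕ) : ℝ) ≠ 0 := by positivity
    rw [mul_div_cancel_left₀ _ h2, Nat.add_sub_cancel]
  refine (HasDerivAt.fun_sum h).congr_deriv ?_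
  rw [sub_eq_neg_add, add_pow, Finset.mul_sum]
  refine Finset.sum_congr rfl fun k _ => ?_
  rw [neg_pow, pow_add]
  ring

/-- The isotropic density `ρ ↦ (c 0 + c 1 ρ² + c 2 ρ⁴) / (4 π)`; the radial density is then
`c 0 ρ² + c 1 ρ⁴ + c 2 ρ⁶`. -/
noncomputable def quarticProfile (c : Fin 3 → ℝ) (ρ : ℝ) : ℝ :=
  (c 0 + c 1 * ρ ^ 2 + c 2 * ρ ^ 4) / (4 * Real.pi)

/-- The tail integral `∫ σ in ρ..R, σ * quarticProfile c σ`. -/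
noncomputable def quarticTail (c : Fin 3 → ℝ) (R ρ : ℝ) : ℝ :=
  (c 0 / 2 * (R ^ 2 - ρ ^ 2) + c 1 / 4 * (R ^ 4 - ρ ^ 4) + c 2 / 6 * (R ^ 6 - ρ ^ 6)) / (4 * Real.pi)

section Quartic

variable (c d : Fin 3 → ℝ) (R r x : ℝ)

lemma continuous_quarticProfile : Continuous (quarticProfile c) := by
  unfold quarticProfile
  fun_prop

lemma quarticProfile_neg : quarticProfile c (-x) = quarticProfile c x := by
  unfold quarticProfile
  ring

lemma hasDerivAt_quarticTail :
    HasDerivAt (quarticTail c R) (-(x * quarticProfile c x)) x := by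
  have h := (((((hasDerivAt_pow 2 x).const_sub (R ^ 2)).const_mul (c 0 / 2)).add
    (((hasDerivAt_pow 4 x).const_sub (R ^ 4)).const_mul (c 1 / 4))).add
    (((hasDerivAt_pow 6 x).const_sub (R ^ 6)).const_mul (c 2 / 6))).div_const (4 * Real.pi)
  refine h.congr_deriv ?_
  unfold quarticProfile
  push_cast
  ring

lemma quarticTail_abs : quarticTail c R |x| = quarticTail c R x := by
  unfold quarticTail
  rw [Even.pow_abs (by decide), Even.pow_abs (by decide), Even.pow_abs (by decide)]

lemma quarticTail_self : quarticTail c R R = 0 := by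
  simp [quarticTail]

/-- An antiderivative of `ρ ↦ 16 π² ρ * quarticProfile c ρ * quarticTail d R (r - ρ)`. -/
noncomputable def quarticConvPrimitive (ρ : ℝ) : ℝ :=
  (d 0 / 2 * R ^ 2 + d 1 / 4 * R ^ 4 + d 2 / 6 * R ^ 6) *
      (c 0 * ρ ^ 2 / 2 + c 1 * ρ ^ 4 / 4 + c 2 * ρ ^ 6 / 6) -
    (d 0 / 2 * (c 0 * mulSubPowPrimitive 1 2 r ρ + c 1 * mulSubPowPrimitive 3 2 r ρ +
        c 2 * mulSubPowPrimitive 5 2 r ρ) +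
      d 1 / 4 * (c 0 * mulSubPowPrimitive 1 4 r ρ + c 1 * mulSubPowPrimitive 3 4 r ρ +
        c 2 * mulSubPowPrimitive 5 4 r ρ) +
      d 2 / 6 * (c 0 * mulSubPowPrimitive 1 6 r ρ + c 1 * mulSubPowPrimitive 3 6 r ρ +
        c 2 * mulSubPowPrimitive 5 6 r ρ))

lemma hasDerivAt_quarticConvPrimitive (ρ : ℝ) :
    HasDerivAt (quarticConvPrimitive c d R r)
      (16 * Real.pi ^ 2 *
        (ρ * quarticProfile c ρ * quarticTail d R (r - ρ))) ρ := by
  have hJ : ∀ j, HasDerivAt (fun ρ => c 0 * mulSubPowPrimitive 1 j r ρ +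
      c 1 * mulSubPowPrimitive 3 j r ρ + c 2 * mulSubPowPrimitive 5 j r ρ)
      ((c 0 * ρ + c 1 * ρ ^ 3 + c 2 * ρ ^ 5) * (r - ρ) ^ j) ρ := fun j => by
    refine ((((hasDerivAt_mulSubPowPrimitive 1 j r ρ).const_mul (c 0)).add
      ((hasDerivAt_mulSubPowPrimitive 3 j r ρ).const_mul (c 1))).add
      ((hasDerivAt_mulSubPowPrimitive 5 j r ρ).const_mul (c 2))).congr_deriv ?_
    ring
  have h1 := (((((hasDerivAt_pow 2 ρ).const_mul (c 0)).div_const 2).add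
    (((hasDerivAt_pow 4 ρ).const_mul (c 1)).div_const 4)).add
    (((hasDerivAt_pow 6 ρ).const_mul (c 2)).div_const 6)).const_mul
    (d 0 / 2 * R ^ 2 + d 1 / 4 * R ^ 4 + d 2 / 6 * R ^ 6)
  have h2 := (((hJ 2).const_mul (d 0 / 2)).add ((hJ 4).const_mul (d 1 / 4))).add
    ((hJ 6).const_mul (d 2 / 6))
  refine (h1.sub h2).congr_deriv ?_
  unfold quarticProfile quarticTail
  have hpi := Real.pi_ne_zero
  field_simp
  push_cast
  ring

lemma integral_quarticProfile_mul_quarticTail (u v : ℝ) :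
    8 * Real.pi ^ 2 * r *
        ∫ ρ in u..v, ρ * quarticProfile c ρ * quarticTail d R (r - ρ) =
      r / 2 * (quarticConvPrimitive c d R r v -
        quarticConvPrimitive c d R r u) := by
  have hc : Continuous fun ρ => 16 * Real.pi ^ 2 *
      (ρ * quarticProfile c ρ * quarticTail d R (r - ρ)) := by
    unfold quarticProfile quarticTail
    fun_prop
  rw [← intervalIntegral.integral_eq_sub_of_hasDerivAt
    (fun ρ _ => hasDerivAt_quarticConvPrimitive c d R r ρ)
    (hc.intervalIntegrable _ _), intervalIntegral.integral_const_mul]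
  ring

end Quartic

/-! ### Static and mobile nodes -/

/-- The profile coefficients of a static node. -/
noncomputable def staticCoeff (R : ℝ) : Fin 3 → ℝ := ![3 / R ^ 3, 0, 0]

/-- The profile coefficients of a mobile (random waypoint) node. -/
noncomputable def mobileCoeff (R : ℝ) : Fin 3 → ℝ :=
  ![35 / 72 * (21 / R ^ 3), -(35 / 72 * (34 / R ^ 5)), 35 / 72 * (13 / R ^ 7)]

lemma quarticProfile_staticCoeff_nonneg {R : ℝ} (hR : 0 < R) (x : ℝ) :
    0 ≤ quarticProfile (staticCoeff R) x := by
  simp only [quarticProfile, staticCoeff, Matrix.cons_val, zero_mul, add_zero]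
  positivity

lemma quarticProfile_mobileCoeff_nonneg {R x : ℝ} (hR : 0 < R) (hx : x ∈ Icc 0 R) :
    0 ≤ quarticProfile (mobileCoeff R) x := by
  have hx2 : x ^ 2 ≤ R ^ 2 := pow_le_pow_left₀ hx.1 hx.2 2
  have h : quarticProfile (mobileCoeff R) x =
      35 * ((R ^ 2 - x ^ 2) * (21 * R ^ 2 - 13 * x ^ 2)) / (72 * R ^ 7 * (4 * Real.pi)) := by
    simp only [quarticProfile, mobileCoeff, Matrix.cons_val]
    field_simp
    ring
  rw [h]
  have h1 : 0 ≤ (R ^ 2 - x ^ 2) * (21 * R ^ 2 - 13 * x ^ 2) :=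
    mul_nonneg (by linarith) (by nlinarith [sq_nonneg x])
  positivity

lemma staticLaw_eq_isotropicLaw {R : ℝ} (hR : 0 < R) :
    staticLaw R = isotropicLaw (quarticProfile (staticCoeff R)) R := by
  have hvol : (volume (closedBall (0 : E3) R))⁻¹ = ENNReal.ofReal (3 / R ^ 3 / (4 * Real.pi)) := by
    rw [EuclideanSpace.volume_closedBall_fin_three, ← ENNReal.ofReal_pow hR.le,
      ← ENNReal.ofReal_mul (by positivity), ← ENNReal.ofReal_inv_of_pos (by positivity)]
    congr 1
    field_simp
  rw [staticLaw, ProbabilityTheory.cond, hvol, isotropicLaw, ← withDensity_const, ← withDensity_indicator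
    measurableSet_closedBall]
  congr 1
  ext x
  by_cases h : ‖x‖ ≤ R
  · rw [indicator_of_mem (by simpa using h), indicator_of_mem (mem_Iic.2 h)]
    simp [quarticProfile, staticCoeff]
  · rw [indicator_of_notMem (by simpa using h), indicator_of_notMem (by simpa using h)]
    simp

lemma mobileLaw_eq_isotropicLaw (R : ℝ) :
    mobileLaw R = isotropicLaw (quarticProfile (mobileCoeff R)) R := by
  rw [mobileLaw, isotropicLaw]
  congr 1
  ext x
  rw [rwpDensity]
  by_cases h : ‖x‖ ≤ R
  · rw [indicator_of_mem (by simpa using h), indicator_of_mem (mem_Iic.2 h)]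
    congr 1
    simp only [quarticProfile, mobileCoeff, Matrix.cons_val]
    field_simp
    ring
  · rw [indicator_of_notMem (by simpa using h), indicator_of_notMem (by simpa using h)]

/-- The profile coefficients of node 1. -/
noncomputable def nodeCoeff₁ (s : Scenario) (R : ℝ) : Fin 3 → ℝ :=
  match s with
  | .s1 => mobileCoeff R
  | .s2 => staticCoeff R
  | .s3 => mobileCoeff R
  | .s4 => staticCoeff R

/-- The profile coefficients of node 2. -/
noncomputable def nodeCoeff₂ (s : Scenario) (R : ℝ) : Fin 3 → ℝ :=
  match s with
  | .s1 => staticCoeff R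
  | .s2 => mobileCoeff R
  | .s3 => mobileCoeff R
  | .s4 => staticCoeff R

lemma nodeLaw₁_eq_isotropicLaw (s : Scenario) {R : ℝ} (hR : 0 < R) :
    nodeLaw₁ s R = isotropicLaw (quarticProfile (nodeCoeff₁ s R)) R := by
  cases s <;> first | exact staticLaw_eq_isotropicLaw hR | exact mobileLaw_eq_isotropicLaw R

lemma nodeLaw₂_eq_isotropicLaw (s : Scenario) {R : ℝ} (hR : 0 < R) :
    nodeLaw₂ s R = isotropicLaw (quarticProfile (nodeCoeff₂ s R)) R := by
  cases s <;> first | exact staticLaw_eq_isotropicLaw hR | exact mobileLaw_eq_isotropicLaw R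

lemma quarticProfile_nodeCoeff₁_nonneg (s : Scenario) {R : ℝ} (hR : 0 < R) :
    ∀ x ∈ Icc 0 R, 0 ≤ quarticProfile (nodeCoeff₁ s R) x := fun x hx => by
  cases s <;> first
    | exact quarticProfile_staticCoeff_nonneg hR x
    | exact quarticProfile_mobileCoeff_nonneg hR hx

lemma quarticProfile_nodeCoeff₂_nonneg (s : Scenario) {R : ℝ} (hR : 0 < R) :
    ∀ x ∈ Icc 0 R, 0 ≤ quarticProfile (nodeCoeff₂ s R) x := fun x hx => by
  cases s <;> first
    | exact quarticProfile_staticCoeff_nonneg hR x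
    | exact quarticProfile_mobileCoeff_nonneg hR hx

/-! ### The polynomial pieces -/

set_option maxHeartbeats 1000000 in
/-- For `r < R₂ - R₁` the integral runs over all of `[-R₁, R₁]`. -/
lemma quarticConvPrimitive_sub_eq_sum_a (s : Scenario) {R₁ R₂ : ℝ} (hR₁ : 0 < R₁) (hR₂ : 0 < R₂)
    (r : ℝ) :
    r / 2 * (quarticConvPrimitive (nodeCoeff₁ s R₁) (nodeCoeff₂ s R₂) R₂ r R₁ -
      quarticConvPrimitive (nodeCoeff₁ s R₁) (nodeCoeff₂ s R₂) R₂ r (-R₁)) =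
        ∑ n ∈ Finset.Icc 1 3, a s R₁ R₂ (2 * n) * r ^ (2 * n) := by
  cases s <;>
    simp only [quarticConvPrimitive, mulSubPowPrimitive, Finset.sum_range_succ, Finset.range_zero,
      Finset.sum_empty, Nat.choose, nodeCoeff₁, nodeCoeff₂, staticCoeff, mobileCoeff,
      Matrix.cons_val] <;>
    norm_num [Finset.sum_Icc_succ_top, a] <;>
    field_simp <;>
    ring

set_option maxHeartbeats 1000000 in
/-- For `R₂ - R₁ ≤ r ≤ R₁ + R₂` the integral runs over `[r - R₂, R₁]`. -/
lemma quarticConvPrimitive_sub_eq_sum_b (s : Scenario) {R₁ R₂ : ℝ} (hR₁ : 0 < R₁) (hR₂ : 0 < R₂)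
    (r : ℝ) :
    r / 2 * (quarticConvPrimitive (nodeCoeff₁ s R₁) (nodeCoeff₂ s R₂) R₂ r R₁ -
      quarticConvPrimitive (nodeCoeff₁ s R₁) (nodeCoeff₂ s R₂) R₂ r (r - R₂)) =
        ∑ n ∈ Finset.Icc 1 13, b s R₁ R₂ n * r ^ n := by
  cases s <;>
    simp only [quarticConvPrimitive, mulSubPowPrimitive, Finset.sum_range_succ, Finset.range_zero,
      Finset.sum_empty, Nat.choose, nodeCoeff₁, nodeCoeff₂, staticCoeff, mobileCoeff,
      Matrix.cons_val] <;>
    norm_num [Finset.sum_Icc_succ_top, b] <;>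
    field_simp <;>
    ring

/-- On `[0, ∞)` the piecewise polynomial density is the isotropic distance density of the two
quartic profiles. -/
lemma distDensity_eq_ite (s : Scenario) {R₁ R₂ : ℝ} (hR₁ : 0 < R₁) (hR : R₁ < R₂) (r : ℝ) :
    distDensity s R₁ R₂ r = if 0 ≤ r then
      isotropicDistDensity (quarticProfile (nodeCoeff₁ s R₁)) (quarticTail (nodeCoeff₂ s R₂) R₂)
        R₁ R₂ r else 0 := by
  have hR₂ := hR₁.trans hR
  have hp := continuous_quarticProfile (nodeCoeff₁ s R₁)
  have heven := quarticProfile_neg (nodeCoeff₁ s R₁)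
  have hN : Continuous (quarticTail (nodeCoeff₂ s R₂) R₂) := continuous_iff_continuousAt.2 fun x =>
    (hasDerivAt_quarticTail (nodeCoeff₂ s R₂) R₂ x).continuousAt
  have habs := quarticTail_abs (nodeCoeff₂ s R₂) R₂
  have hN0 := quarticTail_self (nodeCoeff₂ s R₂) R₂
  rw [distDensity]
  by_cases hr : 0 ≤ r
  · rw [if_pos hr]
    by_cases h1 : r < R₂ - R₁
    · rw [if_pos ⟨hr, h1⟩, isotropicDistDensity_of_lt_sub hp heven hN habs hR₁.le hr h1,
        integral_quarticProfile_mul_quarticTail, quarticConvPrimitive_sub_eq_sum_a s hR₁ hR₂]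
    · rw [if_neg fun h => h1 h.2]
      rw [not_lt] at h1
      by_cases h2 : r ≤ R₁ + R₂
      · rw [if_pos ⟨h1, h2⟩, isotropicDistDensity_of_sub_le hp heven hN habs hN0 hR.le h1 h2,
          integral_quarticProfile_mul_quarticTail, quarticConvPrimitive_sub_eq_sum_b s hR₁ hR₂]
      · rw [if_neg fun h => h2 h.2,
          isotropicDistDensity_of_add_lt hp heven hN hN0 hR₁.le (not_le.1 h2)]
  · rw [if_neg hr, if_neg fun h => hr h.1, if_neg fun h => hr (by linarith [h.1])]

end Internodal

theorem theorem2 {Ω : Type*} [MeasurableSpace Ω] (P : MeasureTheory.Measure Ω)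
    [MeasureTheory.IsProbabilityMeasure P]
    (s : Internodal.Scenario) (R₁ R₂ : ℝ) (hR₁ : 0 < R₁) (hR : R₁ < R₂)
    (X Y : Ω → Internodal.E3)
    (hX : ProbabilityTheory.HasLaw X (Internodal.nodeLaw₁ s R₁) P)
    (hY : ProbabilityTheory.HasLaw Y (Internodal.nodeLaw₂ s R₂) P)
    (hXY : ProbabilityTheory.IndepFun X Y P) :
    (∀ r : ℝ, 0 ≤ Internodal.distDensity s R₁ R₂ r) ∧
    MeasureTheory.HasPDF (fun ω => dist (X ω) (Y ω)) P MeasureTheory.volume ∧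
    MeasureTheory.pdf (fun ω => dist (X ω) (Y ω)) P MeasureTheory.volume
      =ᵐ[MeasureTheory.volume]
        fun r => ENNReal.ofReal (Internodal.distDensity s R₁ R₂ r) := by
  have hR₂ := hR₁.trans hR
  have hf := Internodal.distDensity_eq_ite s hR₁ hR
  have hp₁ := Internodal.continuous_quarticProfile (Internodal.nodeCoeff₁ s R₁)
  have hp₂ := Internodal.continuous_quarticProfile (Internodal.nodeCoeff₂ s R₂)
  have hp₁0 := Internodal.quarticProfile_nodeCoeff₁_nonneg s hR₁
  have hp₂0 := Internodal.quarticProfile_nodeCoeff₂_nonneg s hR₂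
  have hN := Internodal.hasDerivAt_quarticTail (Internodal.nodeCoeff₂ s R₂) R₂
  rw [Internodal.nodeLaw₁_eq_isotropicLaw s hR₁] at hX
  rw [Internodal.nodeLaw₂_eq_isotropicLaw s hR₂] at hY
  have hmeas : Measurable fun r => ENNReal.ofReal (Internodal.distDensity s R₁ R₂ r) := by
    unfold Internodal.distDensity
    exact (Measurable.ite measurableSet_Ico (by fun_prop)
      (Measurable.ite measurableSet_Icc (by fun_prop) measurable_const)).ennreal_ofReal
  have hmap : P.map (fun ω => dist (X ω) (Y ω)) =
      volume.withDensity fun r => ENNReal.ofReal (Internodal.distDensity s R₁ R₂ r) := by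
    rw [Internodal.map_dist_eq_withDensity hX hY hXY hp₁ hp₁0 hp₂ hp₂0 hR₁.le hR₂.le hN]
    congr 1
    ext r
    rw [hf]
    by_cases hr : 0 ≤ r <;> simp [hr]
  have hpdf : HasPDF (fun ω => dist (X ω) (Y ω)) P volume :=
    hasPDF_of_map_eq_withDensity (hX.aemeasurable.dist hY.aemeasurable) _ hmeas.aemeasurable hmap
  refine ⟨fun r => ?_, hpdf, (pdf.eq_of_map_eq_withDensity _ hmeas.aemeasurable).1 hmap⟩
  rw [hf]
  split_ifs with hr
  · exact Internodal.isotropicDistDensity_nonneg hp₁0 hp₂ hp₂0 hR₁.le hR₂.le hN hr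
  · exact le_rfl
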